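/- Let $p$ be an odd prime, let $k$ be a field of characteristic $p$, and let $f\in k[[\zeta]]$ be of the form $f(\zeta)=\zeta\bigl(1+\sum_{j\ge 2}a_j\zeta^j\bigr)$. Write $f^m$ for the $m$-fold composition of $f$ with itself. For $n\ge 0$ put $d(n)=\frac{p^n-1}{p-1}$, and put $\varphi=\tfrac32a_2^3+a_3^2-a_2a_4$ and $\lambda=a_2^{p-3}\varphi$ (with $a_2^0=1$). For $n\ge 1$ let $$\alpha_n=a_2^{p^n-2d(n)}\varphi^{d(n)},\qquad \beta_n=\frac{a_3}{a_2}\,\alpha_n,\qquad \gamma_n=-\Bigl(\frac{3a_2}{2}-\frac{a_4}{a_2}\Bigr)\alpha_n ,$$ where, since $p^n-2d(n)\ge 1$, the factor $a_2$ in the denominators is cancelled formally, so that $\beta_n=a_3a_2^{p^n-2d(n)-1}\varphi^{d(n)}$ and $\gamma_n=-\bigl(\tfrac32a_2^2-a_4\bigr)a_2^{p^n-2d(n)-1}\varphi^{d(n)}$ are also defined when $a_2=0$. Then for every integer $n\ge 1$ $$f^{p^n}(\zeta)-\zeta\equiv \alpha_n\zeta^{2d(n+1)+1}+\beta_n\zeta^{2d(n+1)+2}+\gamma_n\zeta^{2d(n+1)+3}\pmod{\langle\zeta^{2d(n+1)+4}\rangle}.$$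 Call $f$ $2$-ramified if $\operatorname{ord}\bigl((f^{p^n}(\zeta)-\zeta)/\zeta\bigr)=2(1+p+\dots+p^n)$ for all integers $n\ge 0$, where $\operatorname{ord}$ is the lowest degree of a nonzero term and $\operatorname{ord}(0)=+\infty$. In particular, $f$ is $2$-ramified if and only if $a_2\ne 0$ and $\lambda\neq 0$; if $p\ge 5$, then $f$ is $2$-ramified if and only if $\lambda\ne 0$. -/

import Mathlib

open scoped PowerSeries

noncomputable section

namespace Ramified

variable {k : Type*} [Field k]

/-- The `m`-fold composition power `g^m = g ∘ ⋯ ∘ g` of a power series `g` (meant for series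
with zero constant term); `g^0` is the identity series `ζ` and `g^(m+1) = g ∘ g^m`. -/
def compIter (g : k⟦X⟧) : ℕ → k⟦X⟧
  | 0 => PowerSeries.X
  | m + 1 => PowerSeries.subst (compIter g m) g

/-- The quotient `h(ζ) / ζ` of a power series `h` with zero constant term. -/
def divByX (h : k⟦X⟧) : k⟦X⟧ := PowerSeries.mk fun m => PowerSeries.coeff (m + 1) h

theorem X_mul_divByX (h : k⟦X⟧) (h0 : PowerSeries.constantCoeff h = 0) :
    PowerSeries.X * divByX h = h := by
  ext n
  cases n with
  | zero => simp [h0]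
  | succ n => simp [divByX, PowerSeries.coeff_succ_X_mul]

/-- The lower ramification number `i_n(g) = ord ((g^(p^n)(ζ) - ζ) / ζ)`, where `ord 0 = ⊤`. -/
def ramNumber (p : ℕ) (g : k⟦X⟧) (n : ℕ) : ℕ∞ :=
  (divByX (compIter g (p ^ n) - PowerSeries.X)).order

/-- `g` is `b`-ramified: `i_n(g) = b (1 + p + ⋯ + p^n)` for all `n ≥ 0`. -/
def IsRamified (p b : ℕ) (g : k⟦X⟧) : Prop :=
  ∀ n : ℕ, ramNumber p g n = ((b * ∑ i ∈ Finset.range (n + 1), p ^ i : ℕ) : ℕ∞)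

/-- The series `f(ζ) = ζ (1 + ∑_{j ≥ 2} a_j ζ^j)`; the values `a 0` and `a 1` are not used. -/
def series (a : ℕ → k) : k⟦X⟧ :=
  PowerSeries.X * (1 + PowerSeries.mk fun j => if 2 ≤ j then a j else 0)

/-- `d(n) = (p^n - 1) / (p - 1)`; the division of natural numbers is exact. -/
def d (p n : ℕ) : ℕ := (p ^ n - 1) / (p - 1)

/-- `φ = (3/2) a_2^3 + a_3^2 - a_2 a_4`. -/
def phi (a : ℕ → k) : k := 3 / 2 * a 2 ^ 3 + a 3 ^ 2 - a 2 * a 4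

/-- `λ = a_2^(p-3) φ`. -/
def lam (p : ℕ) (a : ℕ → k) : k := a 2 ^ (p - 3) * phi a

/-- `α_n = a_2^(p^n - 2 d(n)) φ^(d(n))`. For `p ≥ 3` the exponent `p^n - 2 d(n)` is positive. -/
def alpha (p : ℕ) (a : ℕ → k) (n : ℕ) : k :=
  a 2 ^ (p ^ n - 2 * d p n) * phi a ^ d p n

/-- `β_n = (a_3 / a_2) α_n`, where the factor `a_2` is cancelled formally, so that the expression
is a polynomial in the coefficients and also has its correct value at `a_2 = 0`. -/
def beta (p : ℕ) (a : ℕ → k) (n : ℕ) : k :=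
  a 3 * (a 2 ^ (p ^ n - 2 * d p n - 1) * phi a ^ d p n)

/-- `γ_n = -(3 a_2 / 2 - a_4 / a_2) α_n`, where the factor `a_2` is cancelled formally. -/
def gamma (p : ℕ) (a : ℕ → k) (n : ℕ) : k :=
  -(3 / 2 * a 2 ^ 2 - a 4) * (a 2 ^ (p ^ n - 2 * d p n - 1) * phi a ^ d p n)

theorem two_mul_d_lt {p : ℕ} (hp : 3 ≤ p) (n : ℕ) : 2 * d p n < p ^ n := by
  have h1 : d p n * (p - 1) ≤ p ^ n - 1 := Nat.div_mul_le_self _ _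
  have h2 : d p n * 2 ≤ d p n * (p - 1) := Nat.mul_le_mul_left _ (by omega)
  have h3 : 0 < p ^ n := Nat.pow_pos (by omega)
  omega

theorem alpha_eq {p : ℕ} (hp : 3 ≤ p) (a : ℕ → k) (n : ℕ) :
    alpha p a n = a 2 * (a 2 ^ (p ^ n - 2 * d p n - 1) * phi a ^ d p n) := by
  have h := two_mul_d_lt hp n
  obtain ⟨e, he⟩ : ∃ e, p ^ n - 2 * d p n = e + 1 := ⟨p ^ n - 2 * d p n - 1, by omega⟩
  rw [alpha, he, Nat.add_sub_cancel, pow_succ]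
  ring

theorem beta_eq {p : ℕ} (hp : 3 ≤ p) (a : ℕ → k) (h2 : a 2 ≠ 0) (n : ℕ) :
    beta p a n = a 3 / a 2 * alpha p a n := by
  rw [alpha_eq hp, beta, ← mul_assoc (a 3 / a 2), div_mul_cancel₀ _ h2]

theorem gamma_eq {p : ℕ} (hp : 3 ≤ p) (a : ℕ → k) (h2 : a 2 ≠ 0) (n : ℕ) :
    gamma p a n = -(3 * a 2 / 2 - a 4 / a 2) * alpha p a n := by
  have h : -(3 / 2 * a 2 ^ 2 - a 4) = -(3 * a 2 / 2 - a 4 / a 2) * a 2 := by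
    rw [neg_mul, sub_mul, div_mul_cancel₀ _ h2]
    ring
  rw [alpha_eq hp, gamma, h, mul_assoc]

end Ramified

end

/-! Substitution of `f` is an algebra endomorphism `φ` of `k⟦X⟧`. With `Δ = φ - 1`, Frobenius in the
endomorphism algebra gives `Δ ^ p = φ ^ p - 1`, so `f^p(ζ) - ζ = Δ ^ p X`. Everything reduces to one
inductive step, `HasExpansion.pow_char`: if `Δ X` starts `X ^ (D + 1) (α + β X + γ X ^ 2)` with `D =
2` in `k`, then the displacement of `φ ^ p` has the same shape with `p * D + 2` for `D` and a
multiple of `(α, β, γ')` for coefficients. The correction `γ' - γ` is nonzero at most when `D = 2`,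
that is, in the first step.

For `α ≠ 0`, commutation of `φ` with `φ ^ p` forces two further vanishing coefficients beyond the
obvious bound and fixes the ratios of the three new ones. The remaining scalar comes from applying
`Δ ^ p` to a test series in which all but one leading contribution is killed; Wilson's theorem
evaluates it. For `α = 0` and `p ≥ 5` the three new coefficients vanish for degree reasons; `p = 3`
needs a direct computation of `Δ ^ 3 X`.

After the first step the triple stays proportional to `(a 2, a 3, a 4 - 3 / 2 * a 2 ^ 2)`, and the
factor obeys the recursion `weight_succ`. -/

namespace Ramified

open PowerSeries

/-! ### Displacement operators and their first three terms. -/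

section Displacement

variable {k : Type*} [Field k]

/-- The displacement operator `h ↦ φ h - h` of an endomorphism `φ`. -/
noncomputable def displ (φ : k⟦X⟧ →ₐ[k] k⟦X⟧) : Module.End k k⟦X⟧ := φ.toLinearMap - 1

theorem displ_apply (φ : k⟦X⟧ →ₐ[k] k⟦X⟧) (h : k⟦X⟧) : displ φ h = φ h - h := rfl

theorem algHom_C (φ : k⟦X⟧ →ₐ[k] k⟦X⟧) (c : k) : φ (C c) = C c := φ.commutes c

theorem displ_C (φ : k⟦X⟧ →ₐ[k] k⟦X⟧) (c : k) : displ φ (C c) = 0 := by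
  rw [displ_apply, algHom_C, sub_self]

theorem displ_C_mul (φ : k⟦X⟧ →ₐ[k] k⟦X⟧) (c : k) (h : k⟦X⟧) :
    displ φ (C c * h) = C c * displ φ h := by
  rw [displ_apply, displ_apply, map_mul, algHom_C, mul_sub]

theorem displ_mul (φ : k⟦X⟧ →ₐ[k] k⟦X⟧) (g h : k⟦X⟧) :
    displ φ (g * h) = displ φ g * φ h + g * displ φ h := by
  simp only [displ_apply, map_mul]
  ring

/-- No continuity of `φ` is needed: splitting off the constant term of `q` and applying the twisted
Leibniz rule gains one factor `X` per round, up to the bound known for `displ φ X`. -/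
theorem X_pow_dvd_displ {φ : k⟦X⟧ →ₐ[k] k⟦X⟧} {D : ℕ} (hφ : X ^ (D + 1) ∣ displ φ X)
    (h : k⟦X⟧) : X ^ (D + 1) ∣ displ φ h := by
  suffices H : ∀ j ≤ D + 1, ∀ q : k⟦X⟧, X ^ j ∣ displ φ q from H _ le_rfl h
  intro j
  induction j with
  | zero => intro _ q; simp
  | succ j ih =>
    intro hj q
    obtain ⟨r, hr⟩ : X ∣ q - C (constantCoeff q) := by
      rw [X_dvd_iff]; simp
    have hq : q = C (constantCoeff q) + X * r := by rw [← hr]; ring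
    rw [hq, map_add, displ_C, zero_add, displ_mul]
    refine dvd_add (Dvd.dvd.mul_right ((pow_dvd_pow X hj).trans hφ) _) ?_
    rw [pow_succ']
    exact mul_dvd_mul_left _ (ih (by omega) r)

theorem displ_X_pow_dvd {φ : k⟦X⟧ →ₐ[k] k⟦X⟧} {D : ℕ} (hφ : X ^ (D + 1) ∣ displ φ X) (m : ℕ) :
    X ^ (m + D) ∣ displ φ (X ^ m) := by
  induction m with
  | zero => rw [pow_zero, ← map_one C, displ_C]; exact dvd_zero _
  | succ m ih =>
    rw [pow_succ', displ_mul]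
    refine dvd_add ?_ ?_
    · have h1 : (X : k⟦X⟧) ∣ φ X := by
        have : φ X = displ φ X + X := by rw [displ_apply]; ring
        rw [this]
        exact dvd_add ((dvd_pow_self X (by omega)).trans hφ) dvd_rfl
      rw [map_pow, show m + 1 + D = (D + 1) + m by ring, pow_add]
      exact mul_dvd_mul hφ (pow_dvd_pow_of_dvd h1 m)
    · rw [show m + 1 + D = 1 + (m + D) by ring, pow_add, pow_one]
      exact mul_dvd_mul_left _ ih

theorem displ_dvd {φ : k⟦X⟧ →ₐ[k] k⟦X⟧} {D : ℕ} (hφ : X ^ (D + 1) ∣ displ φ X) {m : ℕ}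
    {h : k⟦X⟧} (hh : X ^ m ∣ h) : X ^ (m + D) ∣ displ φ h := by
  obtain ⟨q, rfl⟩ := hh
  rw [displ_mul]
  refine dvd_add (Dvd.dvd.mul_right (displ_X_pow_dvd hφ m) _) ?_
  rw [pow_add]
  exact mul_dvd_mul_left _ ((pow_dvd_pow X (Nat.le_succ D)).trans (X_pow_dvd_displ hφ q))

theorem displ_pow_dvd {φ : k⟦X⟧ →ₐ[k] k⟦X⟧} {D : ℕ} (hφ : X ^ (D + 1) ∣ displ φ X) {m : ℕ}
    {h : k⟦X⟧} (hh : X ^ m ∣ h) (j : ℕ) : X ^ (m + j * D) ∣ (displ φ ^ j) h := by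
  induction j with
  | zero => simpa using hh
  | succ j ih =>
    rw [pow_succ', Module.End.mul_apply, add_mul, one_mul, ← add_assoc]
    exact displ_dvd hφ ih

/-- In characteristic `p` the `p`-th power of the displacement operator is the displacement
operator of the `p`-th iterate. -/
theorem displ_pow_char (p : ℕ) [Fact p.Prime] [CharP k p] (φ : k⟦X⟧ →ₐ[k] k⟦X⟧) :
    displ φ ^ p = displ (φ ^ p) := by
  have : CharP (Module.End k k⟦X⟧) p :=
    charP_of_injective_algebraMap (algebraMap k (Module.End k k⟦X⟧)).injective p
  have h1 : (φ ^ p).toLinearMap = φ.toLinearMap ^ p := by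
    ext1 h
    rw [AlgHom.toLinearMap_apply, AlgHom.coe_pow, Module.End.pow_apply]
    rfl
  rw [displ, displ, sub_pow_char_of_commute p (Commute.one_right _), one_pow, h1]

/-- `φ X = X + α X^(D+1) + β X^(D+2) + γ X^(D+3)` up to terms of degree at least `D + 4`. -/
def HasExpansion (φ : k⟦X⟧ →ₐ[k] k⟦X⟧) (D : ℕ) (α β γ : k) : Prop :=
  X ^ (D + 4) ∣ displ φ X - X ^ (D + 1) * (C α + C β * X + C γ * X ^ 2)

theorem HasExpansion.dvd {φ : k⟦X⟧ →ₐ[k] k⟦X⟧} {D : ℕ} {α β γ : k}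
    (hφ : HasExpansion φ D α β γ) : X ^ (D + 1) ∣ displ φ X :=
  (dvd_iff_dvd_of_dvd_sub ((pow_dvd_pow X (by omega)).trans hφ)).2 (dvd_mul_right _ _)

theorem one_add_pow_eq {R : Type*} [CommRing R] (y : R) (m : ℕ) :
    ∃ s, (1 + y) ^ m = 1 + m * y + (m.choose 2 : R) * y ^ 2 + y ^ 3 * s := by
  induction m with
  | zero => exact ⟨0, by simp⟩
  | succ m ih =>
    obtain ⟨s, hs⟩ := ih
    refine ⟨(m.choose 2 : R) + s * (1 + y), ?_⟩
    rw [pow_succ, hs, Nat.choose_succ_succ' m 1, Nat.choose_one_right]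
    push_cast
    ring

/-- `1` if `D = 2` and `0` otherwise: the weight of the second order term of the displacement
operator in relative degree `2`. -/
noncomputable def quadWeight (k : Type*) [Field k] (D : ℕ) : k := if D = 2 then 1 else 0

theorem displ_X_pow {φ : k⟦X⟧ →ₐ[k] k⟦X⟧} {D : ℕ} {α β γ : k} (hD : 2 ≤ D)
    (hφ : HasExpansion φ D α β γ) (m : ℕ) :
    X ^ (m + D + 3) ∣ displ φ (X ^ m) - X ^ (m + D) * (C (m * α) + C (m * β) * X +
      C (m * γ + quadWeight k D * m.choose 2 * α ^ 2) * X ^ 2) := by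
  obtain ⟨r, hr⟩ := hφ
  obtain ⟨u, hu⟩ : ∃ u, u = C α + C β * X + C γ * X ^ 2 + X ^ 3 * r := ⟨_, rfl⟩
  have hX : φ X = X * (1 + X ^ D * u) := by
    rw [displ_apply, sub_eq_iff_eq_add, sub_eq_iff_eq_add] at hr
    rw [hr, hu]
    ring
  obtain ⟨s, hs⟩ := one_add_pow_eq (X ^ D * u) m
  -- The quadratic term of the binomial expansion reaches relative degree 2 only for `D = 2`; for
  -- larger `D` it is absorbed in the error.
  obtain ⟨t, ht⟩ : X ^ 3 ∣ X ^ D * u ^ 2 - C (quadWeight k D * α ^ 2) * X ^ 2 := by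
    rcases hD.eq_or_lt with rfl | hD
    · refine ⟨(C β + C γ * X + X ^ 2 * r) * (u + C α), ?_⟩
      simp only [quadWeight, if_true, one_mul, map_pow, hu]
      ring
    · rw [quadWeight, if_neg (by omega)]
      simp only [zero_mul, map_zero, sub_zero]
      exact Dvd.dvd.mul_right (pow_dvd_pow X hD) _
  obtain ⟨e, rfl⟩ : ∃ e, D = e + 2 := ⟨D - 2, by omega⟩
  refine ⟨(m : k⟦X⟧) * r + (m.choose 2 : k⟦X⟧) * t + X ^ (2 * e + 1) * u ^ 3 * s, ?_⟩
  have hn : (C (m : k) : k⟦X⟧) = m := map_natCast _ _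
  have hc : (C (m.choose 2 : k) : k⟦X⟧) = (m.choose 2 : k⟦X⟧) := map_natCast _ _
  rw [displ_apply, map_pow, hX, mul_pow, hs]
  simp only [map_add, map_mul, hn, hc] at ht ⊢
  linear_combination (X ^ (m + (e + 2)) * (m.choose 2 : k⟦X⟧)) * ht +
    (X ^ (m + (e + 2)) * (m : k⟦X⟧)) * hu

/-- The first three terms of the displacement of a series with given first three terms. -/
theorem displ_expansion {φ : k⟦X⟧ →ₐ[k] k⟦X⟧} {D : ℕ} {α β γ : k} (hD : 2 ≤ D)
    (hφ : HasExpansion φ D α β γ) {N : ℕ} {x₀ x₁ x₂ : k} {h : k⟦X⟧}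
    (hh : X ^ (N + 3) ∣ h - X ^ N * (C x₀ + C x₁ * X + C x₂ * X ^ 2)) :
    X ^ (N + D + 3) ∣ displ φ h - X ^ (N + D) * (C (N * α * x₀) +
      C (N * β * x₀ + (N + 1) * α * x₁) * X +
      C ((N * γ + quadWeight k D * N.choose 2 * α ^ 2) * x₀ + (N + 1) * β * x₁ +
        (N + 2) * α * x₂) * X ^ 2) := by
  have h0 := displ_dvd hφ.dvd hh
  obtain ⟨s, hs⟩ := h0
  obtain ⟨t0, h0⟩ := displ_X_pow hD hφ N
  obtain ⟨t1, h1⟩ := displ_X_pow hD hφ (N + 1)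
  obtain ⟨t2, h2⟩ := displ_X_pow hD hφ (N + 2)
  have e : displ φ (h - X ^ N * (C x₀ + C x₁ * X + C x₂ * X ^ 2)) = displ φ h -
      (C x₀ * displ φ (X ^ N) + C x₁ * displ φ (X ^ (N + 1)) + C x₂ * displ φ (X ^ (N + 2))) := by
    rw [← displ_C_mul, ← displ_C_mul, ← displ_C_mul, ← map_add, ← map_add, ← map_sub]
    congr 1
    ring
  rw [e] at hs
  refine ⟨s + C x₀ * t0 + C x₁ * (X * t1 + C ((N + 1) * γ + quadWeight k D *
    (N + 1).choose 2 * α ^ 2)) + C x₂ * (X ^ 2 * t2 + C ((N + 2) * β) +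
    C ((N + 2) * γ + quadWeight k D * (N + 2).choose 2 * α ^ 2) * X), ?_⟩
  simp only [map_add, map_mul, Nat.cast_add, Nat.cast_one, Nat.cast_ofNat] at *
  linear_combination hs + C x₀ * h0 + C x₁ * h1 + C x₂ * h2

theorem eq_zero_of_X_pow_dvd {M : ℕ} {a b c : k}
    (h : X ^ (M + 3) ∣ X ^ M * (C a + C b * X + C c * X ^ 2)) : a = 0 ∧ b = 0 ∧ c = 0 := by
  rw [pow_add, mul_dvd_mul_iff_left (pow_ne_zero _ X_ne_zero), X_pow_dvd_iff] at h
  have h0 := h 0 (by norm_num)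
  have h1 := h 1 (by norm_num)
  have h2 := h 2 (by norm_num)
  simp [coeff_X_pow, coeff_C] at h0 h1 h2
  exact ⟨h0, h1, h2⟩

theorem expansion_unique {M : ℕ} {h : k⟦X⟧} {a b c a' b' c' : k}
    (h₁ : X ^ (M + 3) ∣ h - X ^ M * (C a + C b * X + C c * X ^ 2))
    (h₂ : X ^ (M + 3) ∣ h - X ^ M * (C a' + C b' * X + C c' * X ^ 2)) :
    a = a' ∧ b = b' ∧ c = c' := by
  have h3 := dvd_sub h₂ h₁
  have e : h - X ^ M * (C a' + C b' * X + C c' * X ^ 2) -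
      (h - X ^ M * (C a + C b * X + C c * X ^ 2)) =
      X ^ M * (C (a - a') + C (b - b') * X + C (c - c') * X ^ 2) := by
    simp only [map_sub]
    ring
  rw [e] at h3
  obtain ⟨h4, h5, h6⟩ := eq_zero_of_X_pow_dvd h3
  exact ⟨sub_eq_zero.1 h4, sub_eq_zero.1 h5, sub_eq_zero.1 h6⟩

theorem exists_expansion {M : ℕ} {h : k⟦X⟧} (hh : X ^ M ∣ h) :
    ∃ a b c : k, X ^ (M + 3) ∣ h - X ^ M * (C a + C b * X + C c * X ^ 2) := by
  obtain ⟨q, rfl⟩ := hh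
  refine ⟨coeff 0 q, coeff 1 q, coeff 2 q, ?_⟩
  rw [← mul_sub, pow_add]
  refine mul_dvd_mul_left _ (X_pow_dvd_iff.2 fun m hm => ?_)
  interval_cases m <;> simp [coeff_X_pow, coeff_C]

end Displacement

/-! ### From an endomorphism to its `p`-th iterate. -/

section Step

variable {k : Type*} [Field k]

/-- By Frobenius, `displ φ (X ^ (p * e)) = displ φ (X ^ e) ^ p`, so a `p`-th power moves by `p * D`
degrees instead of `D`. -/
theorem displ_X_pow_mul_char (p : ℕ) [Fact p.Prime] [CharP k p] {φ : k⟦X⟧ →ₐ[k] k⟦X⟧} {D : ℕ}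
    (hφ : X ^ (D + 1) ∣ displ φ X) (e : ℕ) :
    X ^ (p * e + p * D) ∣ displ φ (X ^ (p * e)) := by
  have : CharP k⟦X⟧ p := charP_of_injective_algebraMap (algebraMap k k⟦X⟧).injective p
  have h : displ φ (X ^ (p * e)) = displ φ (X ^ e) ^ p := by
    rw [displ_apply, displ_apply, sub_pow_char, ← map_pow, ← pow_mul, mul_comm]
  rw [h, ← mul_add, mul_comm, pow_mul]
  exact pow_dvd_pow_of_dvd (displ_X_pow_dvd hφ e) p

/-- Powers `X ^ (p * e)` behave almost like constants: they may be pulled out of iterated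
displacements, with an error of high order from the Leibniz rule. -/
theorem displ_pow_X_pow_mul_char (p : ℕ) [Fact p.Prime] [CharP k p] {φ : k⟦X⟧ →ₐ[k] k⟦X⟧}
    {D : ℕ} (hφ : X ^ (D + 1) ∣ displ φ X) (e : ℕ) (h : k⟦X⟧) (j : ℕ) :
    X ^ (p * e + p * D + j * D) ∣
      (displ φ ^ (j + 1)) (X ^ (p * e) * h) - X ^ (p * e) * (displ φ ^ (j + 1)) h := by
  induction j with
  | zero =>
    simp only [zero_add, pow_one, zero_mul, add_zero, displ_mul, add_sub_cancel_right]
    exact Dvd.dvd.mul_right (displ_X_pow_mul_char p hφ e) _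
  | succ j ih =>
    have h1 := displ_dvd hφ ih
    have h2 : X ^ ((j + 1) * D) ∣ φ ((displ φ ^ (j + 1)) h) := by
      have h3 := displ_pow_dvd hφ (m := 0) (h := h) (by simp) (j + 1)
      have h4 := displ_dvd hφ h3
      have h5 : φ ((displ φ ^ (j + 1)) h) =
          displ φ ((displ φ ^ (j + 1)) h) + (displ φ ^ (j + 1)) h := by
        rw [displ_apply]; ring
      rw [h5]
      rw [zero_add] at h3 h4
      exact dvd_add ((pow_dvd_pow X (Nat.le_add_right _ _)).trans h4) h3
    have h3 := mul_dvd_mul (displ_X_pow_mul_char p hφ e) h2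
    rw [← pow_add] at h3
    have h4 : (displ φ ^ (j + 1 + 1)) (X ^ (p * e) * h) -
        X ^ (p * e) * (displ φ ^ (j + 1 + 1)) h =
        displ φ ((displ φ ^ (j + 1)) (X ^ (p * e) * h) - X ^ (p * e) * (displ φ ^ (j + 1)) h) +
          displ φ (X ^ (p * e)) * φ ((displ φ ^ (j + 1)) h) := by
      rw [pow_succ' _ (j + 1), Module.End.mul_apply, Module.End.mul_apply, map_sub, displ_mul]
      ring
    rw [h4]
    refine dvd_add ?_ h3
    rwa [add_mul, one_mul, ← add_assoc]

theorem displ_leading {φ : k⟦X⟧ →ₐ[k] k⟦X⟧} {D : ℕ} {α β γ : k} (hD : 2 ≤ D)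
    (hφ : HasExpansion φ D α β γ) {m : ℕ} {c : k} {h : k⟦X⟧}
    (hh : X ^ (m + 1) ∣ h - C c * X ^ m) :
    X ^ (m + D + 1) ∣ displ φ h - C (c * m * α) * X ^ (m + D) := by
  have h1 := displ_dvd hφ.dvd hh
  obtain ⟨s, hs⟩ := displ_X_pow hD hφ m
  rw [map_sub, displ_C_mul, show m + 1 + D = m + D + 1 by ring] at h1
  obtain ⟨t, ht⟩ := h1
  refine ⟨t + C c * (X ^ 2 * s + C (m * β) +
    C (m * γ + quadWeight k D * m.choose 2 * α ^ 2) * X), ?_⟩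
  simp only [map_mul] at *
  linear_combination ht + C c * hs

theorem displ_pow_leading {φ : k⟦X⟧ →ₐ[k] k⟦X⟧} {D : ℕ} {α β γ : k} (hD : 2 ≤ D)
    (hφ : HasExpansion φ D α β γ) {m : ℕ} {c : k} {h : k⟦X⟧}
    (hh : X ^ (m + 1) ∣ h - C c * X ^ m) (j : ℕ) :
    X ^ (m + j * D + 1) ∣ (displ φ ^ j) h -
      C (c * (∏ i ∈ Finset.range j, ((m : k) + i * D)) * α ^ j) * X ^ (m + j * D) := by
  induction j with
  | zero => simpa using hh
  | succ j ih =>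
    have h1 := displ_leading hD hφ ih
    rw [pow_succ' (displ φ), Module.End.mul_apply, show m + (j + 1) * D = m + j * D + D by ring,
      Finset.prod_range_succ, show c * ((∏ i ∈ Finset.range j, ((m : k) + i * D)) *
        (m + j * D)) * α ^ (j + 1) = c * (∏ i ∈ Finset.range j, ((m : k) + i * D)) * α ^ j *
        ((m + j * D : ℕ) : k) * α by push_cast; ring]
    exact h1

theorem leading_unique {M : ℕ} {h : k⟦X⟧} {a b : k} (h₁ : X ^ (M + 1) ∣ h - C a * X ^ M)
    (h₂ : X ^ (M + 1) ∣ h - C b * X ^ M) : a = b := by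
  have h3 := X_pow_dvd_iff.1 (dvd_sub h₂ h₁) M (Nat.lt_succ_self M)
  simpa [sub_eq_zero] using h3

theorem two_ne_zero_of_charP (p : ℕ) [Fact p.Prime] [CharP k p] (hp : p ≠ 2) : (2 : k) ≠ 0 :=
  Ring.two_ne_zero (by rwa [ringChar.eq k p])

theorem prod_two_add_mul_two (p : ℕ) [Fact p.Prime] [CharP k p] (hp : p ≠ 2) :
    ∏ i ∈ Finset.range (p - 1), ((2 : k) + i * 2) = -1 := by
  have h0 : ∀ i ∈ Finset.range (p - 1), ((2 : k) + i * 2) = 2 * ((i + 1 : ℕ) : k) := by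
    intro i _; push_cast; ring
  rw [Finset.prod_congr rfl h0, Finset.prod_mul_distrib, Finset.prod_const, Finset.card_range,
    ← Nat.cast_prod, Finset.prod_range_add_one_eq_factorial]
  have : Fact (2 < p) := ⟨by have := (Fact.out : p.Prime).two_le; omega⟩
  have h1 : (2 : ZMod p) ^ (p - 1) = 1 :=
    ZMod.pow_card_sub_one_eq_one (two_ne_zero_of_charP p hp)
  have h2 : ((2 : ZMod p) ^ (p - 1)) * ((p - 1).factorial : ZMod p) = -1 := by
    rw [h1, ZMod.wilsons_lemma, one_mul]
  have h3 := congrArg (ZMod.castHom (dvd_refl p) k) h2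
  rwa [map_mul, map_pow, map_ofNat, map_natCast, map_neg, map_one] at h3

theorem two_mul_choose_two (n : ℕ) : (2 : k) * ((n + 1).choose 2 : k) = (n + 1) * n := by
  have h := Nat.add_one_mul_choose_eq n 1
  rw [Nat.choose_one_right] at h
  have h' := congrArg (Nat.cast : ℕ → k) h
  push_cast at h'
  linear_combination -h'

theorem displ_comm (φ : k⟦X⟧ →ₐ[k] k⟦X⟧) (p : ℕ) (h : k⟦X⟧) :
    displ φ (displ (φ ^ p) h) = displ (φ ^ p) (displ φ h) := by
  have h1 : φ ((φ ^ p) h) = (φ ^ p) (φ h) := by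
    rw [← AlgHom.mul_apply, ← AlgHom.mul_apply, ← pow_succ, ← pow_succ']
  simp only [displ_apply, map_sub, h1]
  ring

/-- Relations between the expansions of two commuting endomorphisms. -/
theorem HasExpansion.comm_relations {φ : k⟦X⟧ →ₐ[k] k⟦X⟧} {p D M : ℕ} {α β γ x₀ x₁ x₂ : k}
    (hD : 2 ≤ D) (hM : 3 ≤ M) (hφ : HasExpansion φ D α β γ)
    (hψ : HasExpansion (φ ^ p) M x₀ x₁ x₂) :
    (M + 1) * α * x₀ = (D + 1) * x₀ * α ∧
    (M + 1) * β * x₀ + (M + 2) * α * x₁ = (D + 1) * x₁ * α + (D + 2) * x₀ * β ∧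
    2 * ((M + 1) * γ * x₀ + (M + 2) * β * x₁ + (M + 3) * α * x₂) +
        quadWeight k D * ((M + 1) * M) * α ^ 2 * x₀ =
      2 * ((D + 1) * x₂ * α + (D + 2) * x₁ * β + (D + 3) * x₀ * γ) := by
  have h1 := displ_expansion hD hφ (N := M + 1) hψ
  have h2 := displ_expansion (by omega : 2 ≤ M) hψ (N := D + 1) hφ
  rw [displ_comm] at h1
  rw [show D + 1 + M = M + 1 + D by ring] at h2
  obtain ⟨e0, e1, e2⟩ := expansion_unique h1 h2
  rw [show quadWeight k M = 0 from if_neg (by omega)] at e2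
  have hc := two_mul_choose_two (k := k) M
  push_cast at e0 e1 e2
  -- Doubling turns the binomial coefficient into `(M + 1) * M`, which can be evaluated in `k`.
  refine ⟨e0, by linear_combination e1, ?_⟩
  linear_combination 2 * e2 - quadWeight k D * α ^ 2 * x₀ * hc

/-- A leading term of the displacement of `φ ^ p` in degree `M + 1` must satisfy `(M - D) α x₀ = 0`.
Since `D = 2` in `k`, this excludes `M = p * D` and `M = p * D + 1`, whose residues are `0` and `1`.
-/
theorem HasExpansion.pow_char_aux {p : ℕ} [Fact p.Prime] [CharP k p] (hp : p ≠ 2)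
    {φ : k⟦X⟧ →ₐ[k] k⟦X⟧} {D : ℕ} {α β γ : k} (hD : 2 ≤ D) (hDp : (D : k) = 2)
    (hφ : HasExpansion φ D α β γ) (hα : α ≠ 0) :
    X ^ (p * D + 3) ∣ displ (φ ^ p) X := by
  have h2 := two_ne_zero_of_charP (k := k) p hp
  have hp3 : 3 ≤ p := by have := (Fact.out : p.Prime).two_le; omega
  have hpD : 6 ≤ p * D := Nat.mul_le_mul hp3 hD
  have hp0 : (p : k) = 0 := CharP.cast_eq_zero k p
  have h0 : X ^ (p * D + 1) ∣ displ (φ ^ p) X := by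
    rw [← displ_pow_char, add_comm]
    exact displ_pow_dvd hφ.dvd (by simp) p
  have key : ∀ M : ℕ, 3 ≤ M → ((M : k) - 2) ≠ 0 → X ^ (M + 1) ∣ displ (φ ^ p) X →
      X ^ (M + 2) ∣ displ (φ ^ p) X := by
    intro M hM hM2 hd
    obtain ⟨x₀, x₁, x₂, hx⟩ := exists_expansion hd
    obtain ⟨e, -, -⟩ := HasExpansion.comm_relations hD hM hφ hx
    have hx0 : x₀ = 0 := by
      have : ((M : k) - 2) * (α * x₀) = 0 := by
        rw [hDp] at e
        linear_combination e
      simpa [hM2, hα] using this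
    refine (dvd_iff_dvd_of_dvd_sub ((pow_dvd_pow X (by omega)).trans hx)).2
      ⟨C x₁ + C x₂ * X, ?_⟩
    rw [hx0, map_zero]
    ring
  refine key (p * D + 1) (by omega) ?_ (key (p * D) (by omega) ?_ h0)
  · push_cast
    rw [hp0]
    intro h
    exact one_ne_zero (α := k) (by linear_combination -h)
  · push_cast
    rw [hp0]
    simpa using h2

/-- The displacement of `φ ^ p` on a test series `u` is computed twice: as the `p`-th power of
`displ φ`, and from the unknown leading coefficient `x₀`. -/
theorem HasExpansion.leading_pow_char {p : ℕ} [Fact p.Prime] [CharP k p] (hp : p ≠ 2)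
    {φ : k⟦X⟧ →ₐ[k] k⟦X⟧} {D : ℕ} {α β γ γ' x₀ x₁ x₂ : k} (hD : 2 ≤ D) (hDp : (D : k) = 2)
    (hφ : HasExpansion φ D α β γ) (hγ : 2 * γ' = 2 * γ - 3 * quadWeight k D * α ^ 2)
    (hα : α ≠ 0) (hψ : HasExpansion (φ ^ p) (p * D + 2) x₀ x₁ x₂) :
    x₀ = α ^ (p - 3) * (β ^ 2 - α * γ') * α := by
  have h2 := two_ne_zero_of_charP (k := k) p hp
  have hp3 : 3 ≤ p := by have := (Fact.out : p.Prime).two_le; omega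
  obtain ⟨N, hN⟩ : ∃ N, p = N + 1 + 2 := ⟨p - 3, by omega⟩
  have hp0 : (p : k) = 0 := CharP.cast_eq_zero k p
  have hN0 : (N : k) = -3 := by
    rw [hN] at hp0; push_cast at hp0; linear_combination hp0
  obtain ⟨e, he⟩ : p ∣ N + 1 + D := by
    rw [← CharP.cast_eq_zero_iff k p]
    push_cast
    rw [hN0, hDp]; ring
  -- The exponent `N + 1 = p - 2` makes the order `N + 1 + D` of `displ φ u` a multiple of `p`; the
  -- coefficient `-2 * β` cancels the next term. What remains is `X ^ (p * e)` times a constant,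
  -- which further displacements kill, plus `2 Φ X ^ 2` and higher terms.
  set u : k⟦X⟧ := X ^ (N + 1) * (C α + C (-2 * β) * X + C 0 * X ^ 2) with hu
  have hu1 := displ_expansion hD hφ (N := N + 1) (h := u) (by rw [hu, sub_self]; exact dvd_zero _)
  have hc := two_mul_choose_two (k := k) N
  have c0 : ((N + 1 : ℕ) : k) * α * α = -2 * α ^ 2 := by
    push_cast; rw [hN0]; ring
  have c1 : ((N + 1 : ℕ) : k) * β * α + (((N + 1 : ℕ) : k) + 1) * α * (-2 * β) = 0 := by
    push_cast; rw [hN0]; ring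
  have c2 : (((N + 1 : ℕ) : k) * γ + quadWeight k D * (N + 1).choose 2 * α ^ 2) * α +
      (((N + 1 : ℕ) : k) + 1) * β * (-2 * β) + (((N + 1 : ℕ) : k) + 2) * α * 0 =
      2 * (β ^ 2 - α * γ') := by
    refine mul_left_cancel₀ h2 ?_
    push_cast
    rw [hN0] at hc ⊢
    linear_combination (2 * α) * hγ + quadWeight k D * α ^ 3 * hc
  rw [c0, c1, c2] at hu1
  set Φ := β ^ 2 - α * γ' with hΦ
  obtain ⟨r, hr⟩ := hu1
  have hr' : displ φ u = X ^ (p * e) * (C (-2 * α ^ 2) + (C (2 * Φ) * X ^ 2 + X ^ 3 * r)) := by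
    rw [← he]
    rw [map_zero] at hr
    linear_combination hr
  have hlead : X ^ (2 + 1) ∣ (C (2 * Φ) * X ^ 2 + X ^ 3 * r) - C (2 * Φ) * X ^ 2 := by
    rw [add_sub_cancel_left]; exact dvd_mul_right _ _
  have hlead' := displ_pow_leading hD hφ hlead (N + 1 + 1)
  have hprod := prod_two_add_mul_two (k := k) p hp
  rw [show p - 1 = N + 1 + 1 by omega] at hprod
  simp only [hDp, Nat.cast_ofNat, hprod] at hlead'
  have hconst : (displ φ ^ (N + 1 + 1)) (C (-2 * α ^ 2)) = 0 := by
    rw [pow_succ, Module.End.mul_apply, displ_C, map_zero]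
  have hmul := displ_pow_X_pow_mul_char p hφ.dvd e
    (C (-2 * α ^ 2) + (C (2 * Φ) * X ^ 2 + X ^ 3 * r)) (N + 1)
  rw [← hr', map_add, hconst, zero_add, ← Module.End.mul_apply, ← pow_succ,
    show N + 1 + 1 + 1 = p by omega, displ_pow_char] at hmul
  have hexp : p * e + (2 + (N + 1 + 1) * D) = N + 1 + (p * D + 2) := by
    rw [← he, hN]; ring
  have hl : X ^ (N + 1 + (p * D + 2) + 1) ∣ displ (φ ^ p) u -
      C (2 * Φ * -1 * α ^ (N + 1 + 1)) * X ^ (N + 1 + (p * D + 2)) := by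
    have h3 := mul_dvd_mul_left (X ^ (p * e)) hlead'
    rw [← pow_add, ← add_assoc, hexp, mul_sub, mul_left_comm, ← pow_add, hexp] at h3
    have h4 : X ^ (N + 1 + (p * D + 2) + 1) ∣ (X : k⟦X⟧) ^ (p * e + p * D + (N + 1) * D) := by
      refine pow_dvd_pow X ?_
      have h5 : (N + 2) * 2 ≤ (N + 2) * D := Nat.mul_le_mul_left _ hD
      have h6 : p * D = (N + 1 + 1) * D + D := by rw [hN]; ring
      have h7 : (N + 1) * D + D = (N + 2) * D := by ring
      rw [← hexp]
      omega
    have h5 := dvd_add (h4.trans hmul) h3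
    rwa [sub_add_sub_cancel] at h5
  have hleadu : X ^ (N + 1 + 1) ∣ u - C α * X ^ (N + 1) := by
    refine ⟨C (-2 * β), ?_⟩
    rw [hu, map_zero]; ring
  have hl' := displ_leading (by omega) hψ hleadu
  have h3 := leading_unique hl hl'
  push_cast at h3
  rw [hN0] at h3
  rw [show p - 3 = N by omega]
  refine mul_left_cancel₀ (mul_ne_zero h2 hα) ?_
  linear_combination h3

theorem HasExpansion.pow_char_of_ne_zero {p : ℕ} [Fact p.Prime] [CharP k p] (hp : p ≠ 2)
    {φ : k⟦X⟧ →ₐ[k] k⟦X⟧} {D : ℕ} {α β γ γ' : k} (hD : 2 ≤ D) (hDp : (D : k) = 2)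
    (hφ : HasExpansion φ D α β γ) (hγ : 2 * γ' = 2 * γ - 3 * quadWeight k D * α ^ 2)
    (hα : α ≠ 0) :
    HasExpansion (φ ^ p) (p * D + 2) (α ^ (p - 3) * (β ^ 2 - α * γ') * α)
      (α ^ (p - 3) * (β ^ 2 - α * γ') * β) (α ^ (p - 3) * (β ^ 2 - α * γ') * γ') := by
  have h2 := two_ne_zero_of_charP (k := k) p hp
  have hp0 : (p : k) = 0 := CharP.cast_eq_zero k p
  obtain ⟨x₀, x₁, x₂, hx⟩ := exists_expansion (hφ.pow_char_aux hp hD hDp hα)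
  replace hx : HasExpansion (φ ^ p) (p * D + 2) x₀ x₁ x₂ := hx
  have h0 := hφ.leading_pow_char hp hD hDp hγ hα hx
  -- With `M = D = 2` in `k` the relations become `α x₁ = β x₀` and `α x₂ = γ' x₀`.
  obtain ⟨-, e1, e2⟩ := hφ.comm_relations hD (by nlinarith [(Fact.out : p.Prime).two_le]) hx
  push_cast at e1 e2
  rw [hp0, hDp] at e1 e2
  have h1 : x₁ = α ^ (p - 3) * (β ^ 2 - α * γ') * β := by
    refine mul_left_cancel₀ hα ?_
    linear_combination e1 + β * h0
  have h3 : x₂ = α ^ (p - 3) * (β ^ 2 - α * γ') * γ' := by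
    refine mul_left_cancel₀ (mul_ne_zero (mul_ne_zero h2 h2) hα) ?_
    linear_combination e2 + (4 * γ') * h0 - 2 * x₀ * hγ
  rwa [← h0, ← h1, ← h3]

/-- For `p = 3` the factor `α ^ (p - 3)` is `1`, so `α = 0` does not make the result trivial and
division by `α` must be avoided. Two facts make three explicit displacements manageable: `3 ∣ D +
1`, and multiples of `X ^ 3` move by one degree more than expected. -/
theorem HasExpansion.pow_three [CharP k 3] {φ : k⟦X⟧ →ₐ[k] k⟦X⟧} {D : ℕ} {α β γ : k}
    (hD : 2 ≤ D) (hDp : (D : k) = 2) (hφ : HasExpansion φ D α β γ) :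
    HasExpansion (φ ^ 3) (3 * D + 2) ((β ^ 2 - α * γ) * α) ((β ^ 2 - α * γ) * β)
      ((β ^ 2 - α * γ) * γ) := by
  have h3 : (3 : k) = 0 := by exact_mod_cast CharP.cast_eq_zero k 3
  have h3' : (3 : k⟦X⟧) = 0 := by
    rw [← map_ofNat C 3, h3, map_zero]
  have : Fact (Nat.Prime 3) := ⟨Nat.prime_three⟩
  obtain ⟨e, he⟩ : 3 ∣ D + 1 := by
    rw [← CharP.cast_eq_zero_iff k 3]
    push_cast
    rw [hDp, ← h3]; norm_num
  have hcube : ∀ r : k⟦X⟧, X ^ (D + 4) ∣ displ φ (X ^ 3 * r) := by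
    intro r
    rw [displ_mul]
    refine dvd_add (Dvd.dvd.mul_right ?_ _) ?_
    · exact (pow_dvd_pow X (by omega)).trans (displ_X_pow_mul_char 3 hφ.dvd 1)
    · rw [show D + 4 = 3 + (D + 1) by ring, pow_add]
      exact mul_dvd_mul_left _ (X_pow_dvd_displ hφ.dvd r)
  obtain ⟨r, hr⟩ := id hφ
  have hr' : displ φ X = X ^ (3 * e) * (C α + C β * X + C γ * X ^ 2 + X ^ 3 * r) := by
    rw [← he]; linear_combination hr
  obtain ⟨s, hs⟩ := displ_X_pow hD hφ 2
  obtain ⟨t, ht⟩ := hcube r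
  -- The coefficient of `X ^ 2` in the bracket is `3 β γ = 0`.
  have hu : displ φ (C α + C β * X + C γ * X ^ 2 + X ^ 3 * r) = X ^ (3 * e) *
      (C (α * β) + C (β ^ 2 - α * γ) * X + X ^ 3 * (C β * r + t + C γ * (X * s +
        C (((2 : ℕ) : k) * γ + quadWeight k D * (Nat.choose 2 2) * α ^ 2)))) := by
    rw [map_add, map_add, map_add, displ_C, displ_C_mul, displ_C_mul, ht, ← he]
    simp only [map_add, map_sub, map_mul, map_pow, Nat.cast_ofNat, map_ofNat] at hs ⊢
    linear_combination C γ * hs + C β * hr + X ^ (D + 1) *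
      (C α * C γ * X + C β * C γ * X ^ 2) * h3'
  obtain ⟨s1, hs1⟩ := displ_X_pow_mul_char 3 hφ.dvd e
  obtain ⟨s2, hs2⟩ := displ_X_pow_mul_char 3 hφ.dvd (e + e)
  obtain ⟨r2, hr2⟩ : ∃ r2, displ φ (displ φ X) = X ^ (3 * (e + e)) *
      (C (α * β) + (C (β ^ 2 - α * γ) * X + X ^ 3 * r2)) := by
    obtain ⟨q, hq⟩ : (X : k⟦X⟧) ^ (3 * (e + e) + 3) ∣ X ^ (3 * e + 3 * D) :=
      pow_dvd_pow X (by omega)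
    rw [hr', displ_mul, hu, hs1, hq]
    refine ⟨q * s1 * φ (C α + C β * X + C γ * X ^ 2 + X ^ 3 * r) + (C β * r + t + C γ * (X * s +
      C (((2 : ℕ) : k) * γ + quadWeight k D * (Nat.choose 2 2) * α ^ 2))), ?_⟩
    rw [mul_add 3 e e, pow_add X _ 3, pow_add X (3 * e)]
    ring
  obtain ⟨t2, ht2⟩ := hcube r2
  obtain ⟨q, hq⟩ : (X : k⟦X⟧) ^ (3 * D + 2 + 4) ∣ X ^ (3 * (e + e) + 3 * D) :=
    pow_dvd_pow X (by omega)
  have hfin : displ (φ ^ 3) X = displ φ (displ φ (displ φ X)) := by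
    rw [← displ_pow_char 3 φ]
    rfl
  have hX : (X : k⟦X⟧) ^ (3 * (e + e)) = X ^ (2 * D + 2) := by
    congr 1; omega
  unfold HasExpansion
  rw [hfin, hr2, displ_mul, hs2, map_add (displ φ), map_add (displ φ), displ_C, displ_C_mul, ht2, hq, hX]
  refine ⟨q * s2 * φ (C (α * β) + (C (β ^ 2 - α * γ) * X + X ^ 3 * r2)) +
    C (β ^ 2 - α * γ) * r + t2, ?_⟩
  simp only [map_mul C]
  generalize C (β ^ 2 - α * γ) = Φ at *
  linear_combination X ^ (2 * D + 2) * Φ * hr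

/-- The expansion of the `p`-th iterate. -/
theorem HasExpansion.pow_char {p : ℕ} [Fact p.Prime] [CharP k p] (hp : p ≠ 2)
    {φ : k⟦X⟧ →ₐ[k] k⟦X⟧} {D : ℕ} {α β γ γ' : k} (hD : 2 ≤ D) (hDp : (D : k) = 2)
    (hφ : HasExpansion φ D α β γ) (hγ : 2 * γ' = 2 * γ - 3 * quadWeight k D * α ^ 2) :
    HasExpansion (φ ^ p) (p * D + 2) (α ^ (p - 3) * (β ^ 2 - α * γ') * α)
      (α ^ (p - 3) * (β ^ 2 - α * γ') * β) (α ^ (p - 3) * (β ^ 2 - α * γ') * γ') := by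
  have h2 := two_ne_zero_of_charP (k := k) p hp
  by_cases hα : α = 0
  · by_cases hp3 : p = 3
    · subst hp3
      have h3 : (3 : k) = 0 := by exact_mod_cast CharP.cast_eq_zero k 3
      have hγ' : γ' = γ := by
        refine mul_left_cancel₀ h2 ?_
        rw [hγ, h3]; ring
      subst hγ'
      simpa using hφ.pow_three hD hDp
    · have hpp : p.Prime := Fact.out
      have hp5 : 5 ≤ p := by
        have := hpp.two_le
        have h4 : p ≠ 4 := by rintro rfl; norm_num at hpp
        omega
      -- With `α = 0` each displacement gains `D + 1` degrees, and `p * (D + 1) + 1 ≥ p * D + 6` as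
      -- `p ≥ 5`.
      have hd : X ^ (D + 1 + 1) ∣ displ φ X := by
        refine (dvd_iff_dvd_of_dvd_sub ((pow_dvd_pow X (by omega)).trans hφ)).2
          ⟨C β + C γ * X, ?_⟩
        rw [hα, map_zero]; ring
      have h5 := displ_pow_dvd hd (m := 1) (h := X) (by simp) p
      rw [displ_pow_char] at h5
      unfold HasExpansion
      simp only [hα, zero_pow (by omega : p - 3 ≠ 0), zero_mul, map_zero, add_zero, mul_zero,
        sub_zero]
      refine (pow_dvd_pow X ?_).trans h5
      rw [mul_add]
      omega
  · exact hφ.pow_char_of_ne_zero hp hD hDp hγ hα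

end Step

/-! ### Iterates of `f`, closed form of the coefficients, and ramification. -/

section Iterates

variable {k : Type*} [Field k]

theorem subst_compIter {g : k⟦X⟧} (hg : HasSubst g) (m : ℕ) :
    HasSubst (compIter g m) ∧
      ∀ h : k⟦X⟧, subst (compIter g m) h = ((substAlgHom hg : k⟦X⟧ →ₐ[k] k⟦X⟧) ^ m) h := by
  induction m with
  | zero => exact ⟨HasSubst.X', fun h => X_subst h⟩
  | succ m ih =>
    have hc := HasSubst.comp hg ih.1
    rw [coe_substAlgHom] at hc
    refine ⟨hc, fun h => ?_⟩
    rw [compIter, ← subst_comp_subst_apply hg ih.1, ih.2, pow_succ, AlgHom.mul_apply,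
      coe_substAlgHom]

theorem compIter_sub_X {g : k⟦X⟧} (hg : HasSubst g) (m : ℕ) :
    compIter g m - X = displ ((substAlgHom hg : k⟦X⟧ →ₐ[k] k⟦X⟧) ^ m) X := by
  have h := subst_compIter hg m
  rw [displ_apply, ← h.2, subst_X h.1]

theorem d_eq_sum {p : ℕ} (hp : 2 ≤ p) (n : ℕ) : d p n = ∑ i ∈ Finset.range n, p ^ i :=
  (Nat.geomSum_eq hp n).symm

theorem d_succ {p : ℕ} (hp : 2 ≤ p) (n : ℕ) : d p (n + 1) = p * d p n + 1 := by
  rw [d_eq_sum hp, d_eq_sum hp, Finset.sum_range_succ', Finset.mul_sum, pow_zero]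
  simp only [pow_succ']

theorem hasSubst_series (a : ℕ → k) : HasSubst (series a) :=
  HasSubst.of_constantCoeff_zero' (by simp [series])

theorem hasExpansion_series (a : ℕ → k) :
    HasExpansion (substAlgHom (hasSubst_series a) : k⟦X⟧ →ₐ[k] k⟦X⟧) 2 (a 2) (a 3) (a 4) := by
  unfold HasExpansion
  rw [displ_apply, coe_substAlgHom, subst_X (hasSubst_series a), X_pow_dvd_iff]
  intro m hm
  have h : series a - X - X ^ (2 + 1) * (C (a 2) + C (a 3) * X + C (a 4) * X ^ 2) =
      X * (PowerSeries.mk (fun j => if 2 ≤ j then a j else 0) - C (a 2) * X ^ 2 -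
        C (a 3) * X ^ 3 - C (a 4) * X ^ 4) := by
    rw [series]; ring
  rw [h]
  cases m with
  | zero => simp
  | succ m =>
    rw [coeff_succ_X_mul]
    have : m < 5 := by omega
    interval_cases m <;> simp [coeff_X_pow]

/-- The common factor of the coefficients `α_n`, `β_n` and `γ_n`. -/
noncomputable def weight (p : ℕ) (a : ℕ → k) (n : ℕ) : k :=
  a 2 ^ (p ^ n - 2 * d p n - 1) * phi a ^ d p n

theorem weight_succ {p : ℕ} (hp : 3 ≤ p) (a : ℕ → k) (n : ℕ) :
    weight p a (n + 1) = weight p a n ^ p * a 2 ^ (p - 3) * phi a := by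
  obtain ⟨E, hE⟩ : ∃ E, p ^ n = E + 2 * d p n + 1 :=
    ⟨p ^ n - 2 * d p n - 1, by have := two_mul_d_lt hp n; omega⟩
  obtain ⟨q, rfl⟩ : ∃ q, p = q + 3 := ⟨p - 3, by omega⟩
  have h : (q + 3) ^ (n + 1) - 2 * d (q + 3) (n + 1) - 1 = (q + 3) * E + q := by
    rw [d_succ (by omega), pow_succ', hE]
    have : (q + 3) * (E + 2 * d (q + 3) n + 1) = (q + 3) * E + 2 * ((q + 3) * d (q + 3) n) +
      q + 3 := by ring
    omega
  rw [weight, weight, h, d_succ (by omega), hE, show E + 2 * d (q + 3) n + 1 -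
    2 * d (q + 3) n - 1 = E by omega, Nat.add_sub_cancel]
  ring

theorem hasExpansion_iterate {p : ℕ} [Fact p.Prime] [CharP k p] (hp : p ≠ 2) (a : ℕ → k)
    (n : ℕ) :
    HasExpansion ((substAlgHom (hasSubst_series a) : k⟦X⟧ →ₐ[k] k⟦X⟧) ^ p ^ (n + 1))
      (2 * d p (n + 2)) (alpha p a (n + 1)) (beta p a (n + 1)) (gamma p a (n + 1)) := by
  have h2 := two_ne_zero_of_charP (k := k) p hp
  have hp2 : 2 ≤ p := (Fact.out : p.Prime).two_le
  have hp3 : 3 ≤ p := by omega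
  have hp0 : (p : k) = 0 := CharP.cast_eq_zero k p
  have hd : ∀ m, ((2 * d p (m + 1) : ℕ) : k) = 2 := by
    intro m
    rw [d_succ hp2]
    push_cast
    rw [hp0]; ring
  have hD : ∀ m, 2 ≤ 2 * d p (m + 1) := by
    intro m
    rw [d_succ hp2]
    omega
  have hd1 : d p 1 = 1 := by rw [d_eq_sum hp2]; simp
  -- `γ` is kept separate from `w`: initially it is `a 4`, and only the corrected value `γ'` is `w *
  -- (a 4 - 3 / 2 * a 2 ^ 2)`. Then `β ^ 2 - α * γ' = w ^ 2 * phi a`.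
  have step : ∀ (m : ℕ) (w γ : k),
      HasExpansion ((substAlgHom (hasSubst_series a) : k⟦X⟧ →ₐ[k] k⟦X⟧) ^ p ^ m)
        (2 * d p (m + 1)) (w * a 2) (w * a 3) γ →
      2 * (w * (a 4 - 3 / 2 * a 2 ^ 2)) =
        2 * γ - 3 * quadWeight k (2 * d p (m + 1)) * (w * a 2) ^ 2 →
      w = weight p a m →
      HasExpansion ((substAlgHom (hasSubst_series a) : k⟦X⟧ →ₐ[k] k⟦X⟧) ^ p ^ (m + 1))
        (2 * d p (m + 2)) (alpha p a (m + 1)) (beta p a (m + 1)) (gamma p a (m + 1)) := by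
    intro m w γ hexp hγ hw
    have h := hexp.pow_char hp (hD m) (hd m) hγ
    rw [← pow_mul, ← pow_succ, show p * (2 * d p (m + 1)) + 2 = 2 * d p (m + 2) by
      rw [d_succ hp2 (m + 1)]; ring] at h
    have hc : ∀ x : k, (w * a 2) ^ (p - 3) * ((w * a 3) ^ 2 -
        w * a 2 * (w * (a 4 - 3 / 2 * a 2 ^ 2))) * (w * x) = weight p a (m + 1) * x := by
      intro x
      rw [weight_succ hp3, ← hw, phi]
      obtain ⟨q, rfl⟩ : ∃ q, p = q + 3 := ⟨p - 3, by omega⟩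
      rw [Nat.add_sub_cancel]
      ring
    rw [hc, hc, hc] at h
    convert h using 1
    · rw [alpha_eq hp3, weight, mul_comm]
    · rw [beta, weight, mul_comm]
    · rw [gamma, weight]; ring
  induction n with
  | zero =>
    refine step 0 1 (a 4) ?_ ?_ (by simp [weight, d])
    · rw [hd1, pow_zero, pow_one, one_mul, one_mul]
      exact hasExpansion_series a
    · rw [hd1, quadWeight, if_pos (by norm_num)]
      field_simp
  | succ n ih =>
    refine step (n + 1) (weight p a (n + 1)) (gamma p a (n + 1)) ?_ ?_ rfl
    · convert ih using 1
      · rw [alpha_eq hp3, weight, mul_comm]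
      · rw [beta, weight, mul_comm]
    -- From here on `D = 2 * d p (n + 2) > 2`, so no correction occurs and `γ' = γ`.
    · rw [quadWeight, if_neg, gamma, weight]
      · ring
      · rw [d_succ hp2, d_succ hp2]
        have := Nat.le_mul_of_pos_right p (by omega : 0 < p * d p n + 1)
        omega

theorem coeff_of_hasExpansion {φ : k⟦X⟧ →ₐ[k] k⟦X⟧} {D : ℕ} {α β γ : k}
    (hφ : HasExpansion φ D α β γ) : coeff (D + 1) (displ φ X) = α := by
  have h := X_pow_dvd_iff.1 hφ (D + 1) (by omega)
  rw [map_sub, sub_eq_zero] at h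
  rw [h, coeff_X_pow_mul']
  simp

theorem order_divByX_eq_iff {φ : k⟦X⟧ →ₐ[k] k⟦X⟧} {D : ℕ} {α β γ : k}
    (hφ : HasExpansion φ D α β γ) : (divByX (displ φ X)).order = D ↔ α ≠ 0 := by
  rw [order_eq_nat, divByX, coeff_mk, coeff_of_hasExpansion hφ]
  refine and_iff_left_of_imp fun _ i hi => ?_
  rw [coeff_mk]
  exact X_pow_dvd_iff.1 hφ.dvd (i + 1) (by omega)

theorem isRamified_series_iff {p : ℕ} [Fact p.Prime] [CharP k p] (hp : p ≠ 2) (a : ℕ → k) :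
    IsRamified p 2 (series a) ↔ a 2 ≠ 0 ∧ phi a ≠ 0 := by
  have hp2 : 2 ≤ p := (Fact.out : p.Prime).two_le
  have hp3 : 3 ≤ p := by omega
  have h0 : ramNumber p (series a) 0 = ((2 * ∑ i ∈ Finset.range (0 + 1), p ^ i : ℕ) : ℕ∞) ↔
      a 2 ≠ 0 := by
    rw [ramNumber, compIter_sub_X (hasSubst_series a), pow_zero, pow_one]
    simpa using order_divByX_eq_iff (hasExpansion_series a)
  have hs : ∀ n, ramNumber p (series a) (n + 1) =
      ((2 * ∑ i ∈ Finset.range (n + 1 + 1), p ^ i : ℕ) : ℕ∞) ↔ alpha p a (n + 1) ≠ 0 := by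
    intro n
    rw [ramNumber, compIter_sub_X (hasSubst_series a), ← d_eq_sum hp2]
    exact order_divByX_eq_iff (hasExpansion_iterate hp a n)
  constructor
  · intro h
    refine ⟨h0.1 (h 0), fun hphi => (hs 0).1 (h 1) ?_⟩
    rw [alpha, hphi, d_succ hp2, zero_pow (Nat.succ_ne_zero _), mul_zero]
  · rintro ⟨ha, hphi⟩ n
    cases n with
    | zero => exact h0.2 ha
    | succ n => exact (hs n).2 (mul_ne_zero (pow_ne_zero _ ha) (pow_ne_zero _ hphi))

end Iterates

end Ramified

theorem theoremB {k : Type*} [Field k] (p : ℕ) [Fact p.Prime] [CharP k p] (hp : p ≠ 2)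
    (a : ℕ → k) :
    (∀ n : ℕ, 1 ≤ n →
      Ramified.compIter (Ramified.series a) (p ^ n) - PowerSeries.X ≡
          PowerSeries.C (Ramified.alpha p a n) *
              PowerSeries.X ^ (2 * Ramified.d p (n + 1) + 1) +
            PowerSeries.C (Ramified.beta p a n) *
              PowerSeries.X ^ (2 * Ramified.d p (n + 1) + 2) +
            PowerSeries.C (Ramified.gamma p a n) *
              PowerSeries.X ^ (2 * Ramified.d p (n + 1) + 3)
        [SMOD (Ideal.span {(PowerSeries.X : k⟦X⟧) ^ (2 * Ramified.d p (n + 1) + 4)})]) ∧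
    (Ramified.IsRamified p 2 (Ramified.series a) ↔ a 2 ≠ 0 ∧ Ramified.lam p a ≠ 0) ∧
    (5 ≤ p → (Ramified.IsRamified p 2 (Ramified.series a) ↔ Ramified.lam p a ≠ 0)) := by
  refine ⟨fun n hn => ?_, ?_, fun h5 => ?_⟩
  · obtain ⟨m, rfl⟩ : ∃ m, n = m + 1 := ⟨n - 1, by omega⟩
    rw [SModEq.sub_mem, Ideal.mem_span_singleton,
      Ramified.compIter_sub_X (Ramified.hasSubst_series a)]
    have h := Ramified.hasExpansion_iterate hp a m
    unfold Ramified.HasExpansion at h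
    convert h using 2
    ring
  · rw [Ramified.isRamified_series_iff hp, Ramified.lam]
    refine and_congr_right fun ha => ?_
    rw [mul_ne_zero_iff, and_iff_right (pow_ne_zero _ ha)]
  -- For `p ≥ 5` the exponent `p - 3` is positive, so `lam p a ≠ 0` already contains `a 2 ≠ 0`.
  · rw [Ramified.isRamified_series_iff hp, Ramified.lam, mul_ne_zero_iff,
      pow_ne_zero_iff (by omega)]
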